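/- Let $G$ be a finitely generated group acting by isometries on a product $X=X_1\times\cdots\times X_N$ of quasi-trees, where each quasi-tree $(X_i,d_i)$ is a metric space quasi-isometric to a simplicial tree (a connected graph without cycles, with its edge-path distance), and $X$ carries the metric $d_X(x,y)=\sum_{i=1}^N d_i(x_i,y_i)$. Let $o\in X$. Then there is an action $\sigma$ of $G$ on the real Banach space $\ell^1=\ell^1(\mathbb N)$ of the form $\sigma(s)v=\pi(s)v+b(s)$, where $\pi$ is a homomorphism from $G$ to the group of bounded invertible linear operators on $\ell^1$ and $b:G\to\ell^1$ satisfies $b(st)=\pi(s)b(t)+b(s)$ for all $s,t\in G$, such that: 1. $\sigma$ is uniformly Lipschitz: there is $L\ge 1$ with $\|\sigma(s)v-\sigma(s)w\|_1\le L\|v-w\|_1$ for all $s\in G$ and $v,w\in\ell^1$; 2. there is a constant $C>0$ with $$\|\sigma(s)0\|_1\ \ge\ \frac1C\,d_X(s\cdot o,o)-C\qquad\text{for all } s\in G.$$ -/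

import Mathlib

/-- A map `g : X → Y` between metric spaces is a quasi-isometric embedding if distances are
preserved up to a multiplicative and an additive constant `A ≥ 1`. -/
def IsQuasiIsometricEmbedding {X Y : Type*} [MetricSpace X] [MetricSpace Y] (g : X → Y) : Prop :=
  ∃ A : ℝ, 1 ≤ A ∧ ∀ x₁ x₂ : X,
    1 / A * dist x₁ x₂ - A ≤ dist (g x₁) (g x₂) ∧ dist (g x₁) (g x₂) ≤ A * dist x₁ x₂ + A

/-- A quasi-isometry is a quasi-isometric embedding with coarsely dense image: for some `C > 0`,
every ball of radius `C` in `Y` meets `g(X)`. -/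
def IsQuasiIsometry {X Y : Type*} [MetricSpace X] [MetricSpace Y] (g : X → Y) : Prop :=
  IsQuasiIsometricEmbedding g ∧
    ∃ C : ℝ, 0 < C ∧ ∀ y : Y, (Metric.ball y C ∩ Set.range g).Nonempty

/-- A metric space `X` is a quasi-tree if it is quasi-isometric to a simplicial tree `T`
(a connected graph without cycles), whose vertex set `V` carries the edge-path distance.
The vertex set is taken in the universe of `X`; this is no restriction, since the subtree
spanned by the image of a quasi-isometry has cardinality at most `max (#X) ℵ₀`. -/
def IsQuasiTree.{u} (X : Type u) [MetricSpace X] : Prop :=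
  ∃ (V : Type u) (_ : MetricSpace V) (T : SimpleGraph V),
    T.IsTree ∧ (∀ v w : V, dist v w = (T.dist v w : ℝ)) ∧ ∃ g : X → V, IsQuasiIsometry g

/-- An action of a group `G` on a real normed space `E` by continuous affine transformations
`v ↦ π s v + b s`: the linear part `π` is a homomorphism into the group of bounded invertible
operators on `E`, and `b` is a cocycle for `π`. -/
structure AffineGroupAction (G E : Type*) [Group G] [NormedAddCommGroup E] [NormedSpace ℝ E] where
  /-- the linear part -/
  π : G →* (E ≃L[ℝ] E)
  /-- the translation part -/
  b : G → E
  /-- the cocycle identity -/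
  cocycle : ∀ s t : G, b (s * t) = π s (b t) + b s

namespace AffineGroupAction

variable {G E : Type*} [Group G] [NormedAddCommGroup E] [NormedSpace ℝ E]

/-- The affine transformation `σ s` of `E`. -/
def act (σ : AffineGroupAction G E) (s : G) (v : E) : E := σ.π s v + σ.b s

theorem act_mul (σ : AffineGroupAction G E) (s t : G) (v : E) :
    σ.act (s * t) v = σ.act s (σ.act t v) := by
  simp only [act, σ.cocycle, map_mul, map_add, add_assoc]
  rfl

theorem act_one (σ : AffineGroupAction G E) (v : E) : σ.act 1 v = v := by
  have h := σ.cocycle 1 1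
  simp at h
  simp only [act, h, map_one, add_zero]
  rfl

/-- The action is uniformly Lipschitz: all the maps `σ s` are `L`-Lipschitz for one constant
`L ≥ 1`. -/
def IsUniformlyLipschitz (σ : AffineGroupAction G E) : Prop :=
  ∃ L : ℝ, 1 ≤ L ∧ ∀ (s : G) (v w : E), dist (σ.act s v) (σ.act s w) ≤ L * dist v w

end AffineGroupAction

/-! Two facts carry the proof: isometries of the product permute its unbounded factors coarsely, and
a group permuting finitely many rooted trees up to bounded distortion acts on `ℓ¹`.

For the first, betweenness in an `ℓ¹` sum is coordinatewise, so an isometry maps a coordinate line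
to a set that splits as an `ℓ¹` product. A quasi-tree has bottlenecks and admits no such splitting
with two large factors (`IsQuasiTree.exists_bound_of_splitting`). Hence each coordinate of the image
depends, up to a uniform constant, on one coordinate of the source. For an unbounded coordinate this
one is unique, so the matching of unbounded factors is a genuine action `τ`
(`exists_coordinate_action`).

For the second, each quasi-tree is mapped to a tree, and the orbit map pulls it back to `G`, which
is coarsely connected because `G` is finitely generated. `IsZeroHyperbolic.exists_parent` then makes
`G` a rooted tree whose paths `B i x` to the root differ boundedly for nearby points. With `D i x`
the sum of the basis vectors indexed by `B i x`, the vector of `(x, i)`, `x ≠ 1`, is the edge `D i x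
- D i (p i x)`. Sending it to the difference of `D (τ s i)` at `s * x` and `s * p i x` gives
operators that are uniformly bounded because `s` distorts edges boundedly, and multiplicative
because the differences telescope. The cocycle is `b s = ∑ i, D i s`; its norm counts depths in the
trees, which dominate the displacement of `o`. -/

/-! ### Gromov products -/

/-- The Gromov product of `x` and `y` with respect to the base point `r`. -/
noncomputable def gromovProduct {V : Type*} [MetricSpace V] (r x y : V) : ℝ :=
  (dist r x + dist r y - dist x y) / 2

/-- Gromov products satisfy the ultrametric inequality. -/
def IsZeroHyperbolic (V : Type*) [MetricSpace V] : Prop :=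
  ∀ r x y z : V, min (gromovProduct r x y) (gromovProduct r y z) ≤ gromovProduct r x z

section GromovProduct

variable {V : Type*} [MetricSpace V]

theorem gromovProduct_comm (r x y : V) : gromovProduct r x y = gromovProduct r y x := by
  simp only [gromovProduct, dist_comm x y]; ring

theorem gromovProduct_nonneg (r x y : V) : 0 ≤ gromovProduct r x y := by
  have := dist_triangle_left x y r
  simp only [gromovProduct]; linarith

theorem gromovProduct_self_left (r x : V) : gromovProduct r r x = 0 := by
  simp [gromovProduct]

theorem gromovProduct_self (r x : V) : gromovProduct r x x = dist r x := by
  simp [gromovProduct]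

theorem gromovProduct_le_left (r x y : V) : gromovProduct r x y ≤ dist r x := by
  have := dist_triangle r x y
  simp only [gromovProduct]; linarith

theorem gromovProduct_le_right (r x y : V) : gromovProduct r x y ≤ dist r y := by
  rw [gromovProduct_comm]; exact gromovProduct_le_left r y x

theorem sub_dist_le_gromovProduct (r x y : V) : dist r y - dist x y ≤ gromovProduct r x y := by
  have := dist_triangle r x y
  simp only [gromovProduct]; linarith

theorem dist_eq_sub_gromovProduct (r x y : V) :
    dist x y = dist r x + dist r y - 2 * gromovProduct r x y := by
  simp only [gromovProduct]; ring

theorem IsZeroHyperbolic.le_gromovProduct (hV : IsZeroHyperbolic V) {r x y z : V} {a : ℝ}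
    (h₁ : a ≤ gromovProduct r x y) (h₂ : a ≤ gromovProduct r y z) : a ≤ gromovProduct r x z :=
  (le_min h₁ h₂).trans (hV r x y z)

end GromovProduct

/-! ### Simplicial trees are zero-hyperbolic -/

namespace SimpleGraph.IsTree

variable {V : Type*} {T : SimpleGraph V}

theorem eq_of_adj_of_dist_add_one (hT : T.IsTree) {r v a b : V} (ha : T.Adj a v)
    (hb : T.Adj b v) (hda : T.dist r v = T.dist r a + 1) (hdb : T.dist r v = T.dist r b + 1) :
    a = b := by
  obtain ⟨p, -, hp⟩ := hT.connected.exists_path_of_dist r a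
  obtain ⟨q, -, hq⟩ := hT.connected.exists_path_of_dist r b
  have hp' : (p.concat ha).IsPath := Walk.isPath_of_length_eq_dist _ (by simp [hp, hda])
  have hq' : (q.concat hb).IsPath := Walk.isPath_of_length_eq_dist _ (by simp [hq, hdb])
  have h := (hT.existsUnique_path r v).unique hp' hq'
  have := congrArg Walk.penultimate h
  simpa using this

/-- Each vertex has only one neighbour nearer to the root, so a path that has taken a step away from
the root, here from `w` to `x`, can never turn back. -/
theorem dist_eq_add_length (hT : T.IsTree) (r : V) {x y : V} (p : T.Walk x y) (hp : p.IsPath)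
    (w : V) (hw : T.Adj w x) (hwp : w ∉ p.support) (hd : T.dist r x = T.dist r w + 1) :
    T.dist r y = T.dist r x + p.length := by
  induction p generalizing w with
  | nil => simp
  | @cons u v y h p ih =>
    rw [Walk.cons_isPath_iff] at hp
    have hvw : v ≠ w := by
      rintro rfl
      exact hwp (by simp)
    have hv : T.dist r v = T.dist r u + 1 := by
      rcases hT.dist_eq_dist_add_one_of_adj r h with h1 | h1
      · exact absurd (hT.eq_of_adj_of_dist_add_one h.symm hw h1 hd) hvw
      · exact h1
    rw [ih hp.1 u h hp.2 hv, hv, Walk.length_cons]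
    ring

/-- If `y` is not further from the root `r` than `x ≠ y`, the geodesic from `x` to `y` starts with
the edge from `x` towards `r`. -/
theorem dist_eq_one_add_of_le (hT : T.IsTree) {r x y a : V} (hxy : x ≠ y)
    (hle : T.dist r y ≤ T.dist r x) (ha : T.Adj a x) (hda : T.dist r x = T.dist r a + 1) :
    T.dist x y = T.dist a y + 1 := by
  obtain ⟨p, hp, hpl⟩ := hT.connected.exists_path_of_dist x y
  cases p with
  | nil => exact absurd rfl hxy
  | @cons _ v _ h p =>
    rw [Walk.cons_isPath_iff] at hp
    rw [Walk.length_cons] at hpl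
    rcases hT.dist_eq_dist_add_one_of_adj r h with h1 | h1
    · obtain rfl := hT.eq_of_adj_of_dist_add_one h.symm ha h1 hda
      have h2 := T.dist_le p
      have h3 := hT.connected.dist_triangle (u := x) (v := v) (w := y)
      have h4 := dist_eq_one_iff_adj.2 h
      omega
    · have := hT.dist_eq_add_length r p hp.1 x h hp.2 h1
      omega

theorem exists_adj_dist_add_one (hT : T.IsTree) {r x : V} (h : T.dist r x ≠ 0) :
    ∃ a, T.Adj a x ∧ T.dist r x = T.dist r a + 1 := by
  obtain ⟨p, -, hpl⟩ := hT.connected.exists_path_of_dist x r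
  cases p with
  | nil => simp at h
  | @cons _ v _ hv p =>
    refine ⟨v, hv.symm, ?_⟩
    rw [Walk.length_cons] at hpl
    rcases hT.dist_eq_dist_add_one_of_adj r hv with h1 | h1
    · exact h1
    · have := T.dist_le p
      rw [dist_comm] at this
      rw [dist_comm] at hpl
      omega

/-- Moving the point furthest from the root one edge towards it lowers its distances to the root and
to the other two points by one each, so the doubled Gromov products do not change. Induction on the
sum of the three heights. -/
theorem min_gromov_le (hT : T.IsTree) (r : V) (n : ℕ) : ∀ x y z : V,
    T.dist r x + T.dist r y + T.dist r z ≤ n →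
    min ((T.dist r x : ℤ) + T.dist r y - T.dist x y) (T.dist r y + T.dist r z - T.dist y z) ≤
      T.dist r x + T.dist r z - T.dist x z := by
  induction n with
  | zero =>
    intro x y z h
    have h1 : T.dist r x = 0 := by omega
    have h2 : T.dist r y = 0 := by omega
    have h3 : T.dist r z = 0 := by omega
    rw [hT.connected.dist_eq_zero_iff] at h1 h2 h3
    subst h1 h2 h3
    simp
  | succ n ih =>
    intro x y z h
    have txz := hT.connected.dist_triangle (u := x) (v := r) (w := z)
    have txy := hT.connected.dist_triangle (u := r) (v := y) (w := x)
    have tyz := hT.connected.dist_triangle (u := r) (v := y) (w := z)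
    have txy' := hT.connected.dist_triangle (u := r) (v := x) (w := y)
    have cxr := T.dist_comm (u := x) (v := r)
    have cyx := T.dist_comm (u := x) (v := y)
    have czy := T.dist_comm (u := z) (v := y)
    have czx := T.dist_comm (u := z) (v := x)
    by_cases hxy : x = y
    · subst hxy; simp
    by_cases hyz : y = z
    · subst hyz; simp
    by_cases hxz : x = z
    · subst hxz
      rw [T.dist_self]
      omega
    by_cases hx : T.dist r y ≤ T.dist r x ∧ T.dist r z ≤ T.dist r x
    · by_cases h0 : T.dist r x = 0
      · have h2 : T.dist r y = 0 := by omega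
        rw [hT.connected.dist_eq_zero_iff] at h0 h2
        exact absurd (h0.symm.trans h2) hxy
      obtain ⟨a, ha, hda⟩ := hT.exists_adj_dist_add_one h0
      have e1 := hT.dist_eq_one_add_of_le hxy hx.1 ha hda
      have e2 := hT.dist_eq_one_add_of_le hxz hx.2 ha hda
      have := ih a y z (by omega)
      omega
    by_cases hy : T.dist r x ≤ T.dist r y ∧ T.dist r z ≤ T.dist r y
    · by_cases h0 : T.dist r y = 0
      · have h2 : T.dist r x = 0 := by omega
        rw [hT.connected.dist_eq_zero_iff] at h0 h2
        exact absurd (h2.symm.trans h0) hxy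
      obtain ⟨a, ha, hda⟩ := hT.exists_adj_dist_add_one h0
      have e1 := hT.dist_eq_one_add_of_le (Ne.symm hxy) hy.1 ha hda
      have e2 := hT.dist_eq_one_add_of_le hyz hy.2 ha hda
      have := ih x a z (by omega)
      have := T.dist_comm (u := x) (v := a)
      omega
    · by_cases h0 : T.dist r z = 0
      · omega
      obtain ⟨a, ha, hda⟩ := hT.exists_adj_dist_add_one h0
      have e1 := hT.dist_eq_one_add_of_le (Ne.symm hxz) (by omega) ha hda
      have e2 := hT.dist_eq_one_add_of_le (Ne.symm hyz) (by omega) ha hda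
      have := ih x y a (by omega)
      have := T.dist_comm (u := x) (v := a)
      have := T.dist_comm (u := y) (v := a)
      omega

end SimpleGraph.IsTree

theorem isZeroHyperbolic_of_isTree {V : Type*} [MetricSpace V] {T : SimpleGraph V} (hT : T.IsTree)
    (hd : ∀ v w : V, dist v w = (T.dist v w : ℝ)) : IsZeroHyperbolic V := by
  intro r x y z
  have h := hT.min_gromov_le r _ x y z le_rfl
  simp only [gromovProduct, hd]
  rw [min_le_iff] at h ⊢
  rcases h with h | h
  · left
    have : ((T.dist r x : ℝ) + T.dist r y - T.dist x y) ≤ T.dist r x + T.dist r z - T.dist x z := by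
      exact_mod_cast h
    linarith
  · right
    have : ((T.dist r y : ℝ) + T.dist r z - T.dist y z) ≤ T.dist r x + T.dist r z - T.dist x z := by
      exact_mod_cast h
    linarith

/-! ### Coarse paths and rooted trees in zero-hyperbolic spaces -/

theorem Relation.ReflTransGen.exists_crossing {α : Type*} {R : α → α → Prop} {x y : α}
    (h : Relation.ReflTransGen R x y) {Q : α → Prop} (hx : ¬ Q x) (hy : Q y) :
    ∃ a b, R a b ∧ ¬ Q a ∧ Q b := by
  induction h with
  | refl => exact absurd hy hx
  | @tail b c _ hbc ih =>
    by_cases hb : Q b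
    · exact ih hb
    · exact ⟨b, c, hbc, hb, hy⟩

/-- A coarse path from `x` to `z` contains a point whose branching point off the geodesic `[x, z]`
is at distance at least `l` from `x`, and which is at distance less than `l + J` from `x`. -/
theorem IsZeroHyperbolic.exists_on_chain {V S : Type*} [MetricSpace V] (hV : IsZeroHyperbolic V)
    (f : S → V) {J : ℝ} (hJ : 0 < J) {P : S → Prop} {x z : S} (hx : P x)
    (h : Relation.ReflTransGen (fun a b => P b ∧ dist (f a) (f b) ≤ J) x z)
    {l : ℝ} (hl : l ≤ dist (f x) (f z)) :
    ∃ y, P y ∧ l ≤ gromovProduct (f x) (f y) (f z) ∧ dist (f x) (f y) < max l 0 + J := by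
  by_cases hl0 : l ≤ 0
  · exact ⟨x, hx, hl0.trans (gromovProduct_nonneg _ _ _), by simp; positivity⟩
  push Not at hl0
  obtain ⟨a, b, ⟨hb, hab⟩, hQa, hQb⟩ := h.exists_crossing
    (Q := fun y => l ≤ gromovProduct (f x) (f y) (f z))
    (by simp [gromovProduct_self_left, hl0]) (by simpa [gromovProduct_self] using hl)
  refine ⟨b, hb, hQb, ?_⟩
  -- The branching point passes `l` between `a` and `b`, so the geodesics to `a` and `b` separate
  -- before `l`; a jump of length at most `J` then keeps `b` within `l + J`.
  have h1 : gromovProduct (f x) (f a) (f b) < l := by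
    by_contra! h1
    exact hQa (hV.le_gromovProduct h1 hQb)
  have h2 := sub_dist_le_gromovProduct (f x) (f a) (f b)
  have := le_max_left l 0
  linarith

open scoped Classical in
/-- Points of a coarsely connected subset of a tree can be organised in a rooted tree: `p` is the
parent map and `B x` is the set of vertices on the path from `x` to the root `o`, without `o`. -/
theorem IsZeroHyperbolic.exists_parent {V S : Type*} [MetricSpace V] (hV : IsZeroHyperbolic V)
    (f : S → V) {J : ℝ} (hJ : 0 < J) (o : S)
    (hc : ∀ x, Relation.ReflTransGen (fun a b => dist (f a) (f b) ≤ J) o x) :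
    ∃ (p : S → S) (B : S → Finset S), B o = ∅ ∧
      (∀ x, x ≠ o → x ∉ B (p x) ∧ B x = insert x (B (p x))) ∧
      (∀ x, x ≠ o → dist (f x) (f (p x)) ≤ 3 * J) ∧
      ∀ M : ℝ, ∃ L : ℕ, ∀ x y, dist (f x) (f y) ≤ M → (symmDiff (B x) (B y)).card ≤ L := by
  set gp : S → S → ℝ := fun x y => gromovProduct (f o) (f x) (f y) with hgp
  set n : S → ℕ := fun x => ⌊dist (f o) (f x) / J⌋₊ with hn
  have hn_le : ∀ x, n x * J ≤ dist (f o) (f x) := fun x => by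
    rw [← le_div_iff₀ hJ]; exact Nat.floor_le (by positivity)
  have hn_lt : ∀ x, dist (f o) (f x) < (n x + 1) * J := fun x => by
    rw [← div_lt_iff₀ hJ]; exact Nat.lt_floor_add_one _
  have hn_of : ∀ x (k : ℕ), k * J ≤ dist (f o) (f x) → k ≤ n x := fun x k h => by
    apply Nat.le_floor; rwa [le_div_iff₀ hJ]
  have hno : n o = 0 := by simp [hn]
  -- Points of level `k` whose geodesic from `o` follows that to `x` up to height `k * J`: the
  -- candidates for the ancestor of `x` at level `k`.
  set Z : S → ℕ → Set S := fun x k => {z | k * J ≤ gp z x ∧ n z = k} with hZ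
  have hZne : ∀ x k, k ≤ n x → (Z x k).Nonempty := by
    intro x k hk
    have hkx : k * J ≤ dist (f o) (f x) :=
      le_trans (by gcongr) (hn_le x)
    rcases Nat.eq_zero_or_pos k with rfl | hk0
    · exact ⟨o, by simp [hgp, gromovProduct_self_left], hno⟩
    obtain ⟨y, -, hy1, hy2⟩ := hV.exists_on_chain f hJ (P := fun _ => True) trivial
      (by simpa using hc x) hkx
    refine ⟨y, hy1, le_antisymm ?_ (hn_of y k (hy1.trans (gromovProduct_le_left _ _ _)))⟩
    have h0 : (0 : ℝ) ≤ k * J := by positivity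
    rw [max_eq_left h0] at hy2
    have : (n y : ℝ) * J < (k + 1) * J := by linarith [hn_le y]
    have := lt_of_mul_lt_mul_right this hJ.le
    exact Nat.lt_add_one_iff.1 (by exact_mod_cast this)
  have hZeq : ∀ x y (k : ℕ), k * J ≤ gp x y → Z x k = Z y k := by
    intro x y k h
    ext z
    simp only [hZ, Set.mem_ofPred_eq, hgp] at *
    constructor
    · rintro ⟨h1, h2⟩; exact ⟨hV.le_gromovProduct h1 h, h2⟩
    · rintro ⟨h1, h2⟩
      rw [gromovProduct_comm] at h
      exact ⟨hV.le_gromovProduct h1 h, h2⟩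
  -- The choice depends on the set alone, so points with the same candidates get the same ancestor.
  set ch : Set S → S := fun A => if h : A.Nonempty then h.choose else o with hch
  set rep : S → ℕ → S := fun x k => if k = 0 then o else ch (Z x k) with hrep
  have hrep0 : ∀ x, rep x 0 = o := fun x => by simp [hrep]
  have hrepZ : ∀ x k, k ≤ n x → rep x k ∈ Z x k := by
    intro x k hk
    rcases Nat.eq_zero_or_pos k with rfl | hk0
    · rw [hrep0]; exact ⟨by simp [hgp, gromovProduct_self_left], hno⟩
    · have h := hZne x k hk
      simp only [hrep, hch, hk0.ne', if_false, dif_pos h]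
      exact h.choose_spec
  have hrepn : ∀ x k, k ≤ n x → n (rep x k) = k := fun x k hk => (hrepZ x k hk).2
  have hrep_eq : ∀ x y (k : ℕ), k * J ≤ gp x y → rep x k = rep y k := by
    intro x y k h
    simp only [hrep, hZeq x y k h]
  have hrep_rep : ∀ x k l, k ≤ n x → l ≤ k → rep (rep x k) l = rep x l := by
    intro x k l hk hl
    refine hrep_eq _ _ _ (le_trans ?_ (hrepZ x k hk).1)
    gcongr
  -- A chosen representative of its level has as parent the representative one level down; any other
  -- point hangs from the representative of its own level.
  set p : S → S := fun x => if x = rep x (n x) then rep x (n x - 1) else rep x (n x) with hp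
  set A : S → ℕ → Finset S := fun x k => (Finset.range (k + 1)).image (rep x) with hA
  have hA_rep : ∀ x k, k ≤ n x → A (rep x k) k = A x k := by
    intro x k hk
    refine Finset.image_congr fun l hl => ?_
    have hl' : l < k + 1 := by simpa using hl
    exact hrep_rep x k l hk (by omega)
  set B : S → Finset S := fun x => (insert x (A x (n x))).erase o with hB
  have hB_rep : ∀ x k, k ≤ n x → B (rep x k) = (A x k).erase o := by
    intro x k hk
    simp only [hB, hrepn x k hk, hA_rep x k hk]
    congr 1
    refine Finset.insert_eq_self.2 ?_
    exact Finset.mem_image_of_mem _ (by simp)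
  have hnA : ∀ x k z, k ≤ n x → z ∈ A x k → n z ≤ k ∧ z = rep x (n z) := by
    intro x k z hk hz
    obtain ⟨l, hl, rfl⟩ := Finset.mem_image.1 hz
    have hl' : l < k + 1 := by simpa using hl
    rw [hrepn x l (by omega)]
    exact ⟨by omega, rfl⟩
  have hdrep : ∀ x k, k ≤ n x → dist (f x) (f (rep x k)) ≤ (n x - k + 2) * J := by
    intro x k hk
    obtain ⟨h1, h2⟩ := hrepZ x k hk
    have h3 := hn_lt x
    have h4 := hn_lt (rep x k)
    rw [h2] at h4
    rw [dist_comm, dist_eq_sub_gromovProduct (f o)]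
    simp only [hgp] at h1
    linarith
  have hn0 : ∀ x, x ≠ o → x = rep x (n x) → 1 ≤ n x := by
    intro x hx h
    by_contra h0
    have h0 : n x = 0 := by omega
    rw [h0, hrep0] at h
    exact hx h
  refine ⟨p, B, ?_, ?_, ?_, ?_⟩
  · have := hB_rep o 0 (Nat.zero_le _)
    rw [hrep0] at this
    rw [this]
    simp [hA, hrep0]
  · intro x hx
    by_cases hxr : x = rep x (n x)
    · have h1 := hn0 x hx hxr
      have hpx : p x = rep x (n x - 1) := by simp only [hp]; rw [if_pos hxr]
      rw [hpx, hB_rep x _ (by omega)]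
      constructor
      · intro hmem
        have := (hnA x _ x (by omega) (Finset.mem_of_mem_erase hmem)).1
        omega
      · have hAx : A x (n x) = insert x (A x (n x - 1)) := by
          simp only [hA]
          rw [Finset.range_add_one, Finset.image_insert, ← hxr, Nat.sub_add_cancel h1]
        simp only [hB]
        rw [hAx, Finset.insert_idem, Finset.erase_insert_of_ne hx]
    · have hpx : p x = rep x (n x) := by simp only [hp]; rw [if_neg hxr]
      rw [hpx, hB_rep x _ le_rfl]
      constructor
      · intro hmem
        exact hxr (hnA x _ x le_rfl (Finset.mem_of_mem_erase hmem)).2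
      · simp only [hB]
        rw [Finset.erase_insert_of_ne hx]
  · intro x hx
    by_cases hxr : x = rep x (n x)
    · have h1 := hn0 x hx hxr
      have hpx : p x = rep x (n x - 1) := by simp only [hp]; rw [if_pos hxr]
      rw [hpx]
      refine (hdrep x _ (by omega)).trans ?_
      rw [Nat.cast_sub h1]
      apply le_of_eq; push_cast; ring
    · have hpx : p x = rep x (n x) := by simp only [hp]; rw [if_neg hxr]
      rw [hpx]
      refine (hdrep x _ le_rfl).trans ?_
      nlinarith
  · intro M
    have key : ∀ x y, dist (f x) (f y) ≤ M → (B x \ B y).card ≤ ⌈M / J⌉₊ + 2 := by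
      intro x y hxy
      have hsub : B x \ B y ⊆
          insert x ((Finset.Icc (n x - ⌈M / J⌉₊) (n x)).image (rep x)) := by
        intro z hz
        rw [Finset.mem_sdiff] at hz
        obtain ⟨hzx, hzy⟩ := hz
        simp only [hB, Finset.mem_erase, Finset.mem_insert] at hzx hzy
        obtain ⟨hzo, rfl | hzA⟩ := hzx
        · exact Finset.mem_insert_self _ _
        apply Finset.mem_insert_of_mem
        obtain ⟨k, hk, rfl⟩ := Finset.mem_image.1 hzA
        have hk' : k < n x + 1 := by simpa using hk
        refine Finset.mem_image_of_mem _ (Finset.mem_Icc.2 ⟨?_, by omega⟩)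
        by_contra! hlt
        -- More than `M / J` levels below `x`, the geodesics to `x` and `y` still agree, so the
        -- ancestors coincide. Only the top `⌈M / J⌉₊ + 1` levels and `x` itself can differ.
        have hkgp : k * J ≤ gp x y := by
          have h1 := sub_dist_le_gromovProduct (f o) (f y) (f x)
          rw [gromovProduct_comm, dist_comm (f y)] at h1
          have h2 := hn_le x
          have h3 : (k : ℝ) + ⌈M / J⌉₊ ≤ n x := by
            exact_mod_cast (by omega : k + ⌈M / J⌉₊ ≤ n x)
          have h4 : M ≤ ⌈M / J⌉₊ * J := by
            rw [← div_le_iff₀ hJ]; exact Nat.le_ceil _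
          have h5 : ((k : ℝ) + ⌈M / J⌉₊) * J ≤ n x * J := by gcongr
          simp only [hgp]
          linarith
        have hky : k ≤ n y := hn_of y k (hkgp.trans (gromovProduct_le_right _ _ _))
        refine hzy ⟨hzo, Or.inr ?_⟩
        rw [hrep_eq x y k hkgp]
        exact Finset.mem_image_of_mem _ (by simpa using Nat.lt_succ_of_le hky)
      refine (Finset.card_le_card hsub).trans ((Finset.card_insert_le _ _).trans ?_)
      have := Finset.card_image_le (s := Finset.Icc (n x - ⌈M / J⌉₊) (n x)) (f := rep x)
      rw [Nat.card_Icc] at this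
      omega
    refine ⟨2 * (⌈M / J⌉₊ + 2), fun x y hxy => ?_⟩
    rw [symmDiff, Finset.sup_eq_union]
    refine (Finset.card_union_le _ _).trans ?_
    have h1 := key x y hxy
    have h2 := key y x (by rwa [dist_comm])
    omega

/-! ### Bounded operators on `ℓ¹` -/

namespace ellOne

/-- The real Banach space `ℓ¹(ℕ)`. -/
abbrev Space : Type := lp (fun _ : ℕ => ℝ) 1

/-- The standard basis vectors of `ℓ¹(ℕ)`. -/
noncomputable def basisVec (n : ℕ) : Space := lp.single 1 n 1

theorem norm_basisVec (n : ℕ) : ‖basisVec n‖ = 1 := by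
  simp [basisVec, lp.norm_single]

theorem hasSum_norm (v : Space) : HasSum (fun n => ‖v n‖) ‖v‖ := by
  simpa using lp.hasSum_norm (p := 1) (by simp) v

theorem hasSum_basisVec (v : Space) : HasSum (fun n => v n • basisVec n) v := by
  have h := lp.hasSum_single (p := 1) (by simp) v
  convert h using 2 with n
  rw [basisVec, ← lp.single_smul]
  simp

theorem clm_ext {E : Type*} [NormedAddCommGroup E] [NormedSpace ℝ E] {S T : Space →L[ℝ] E}
    (h : ∀ n, S (basisVec n) = T (basisVec n)) : S = T := by
  ext v
  have h1 := S.hasSum (hasSum_basisVec v)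
  have h2 := T.hasSum (hasSum_basisVec v)
  simp only [map_smul, h] at h1 h2
  exact h1.unique h2

/-- A bounded family of vectors is the image of the standard basis under a bounded operator. -/
theorem exists_clm {E : Type*} [NormedAddCommGroup E] [NormedSpace ℝ E] [CompleteSpace E]
    (u : ℕ → E) {L : ℝ} (hu : ∀ n, ‖u n‖ ≤ L) :
    ∃ T : Space →L[ℝ] E, (∀ n, T (basisVec n) = u n) ∧ ∀ v, ‖T v‖ ≤ L * ‖v‖ := by
  have hle : ∀ (v : Space) n, ‖v n • u n‖ ≤ L * ‖v n‖ := fun v n => by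
    rw [norm_smul, mul_comm]
    gcongr
    exact hu n
  have hs : ∀ v : Space, Summable fun n => v n • u n := fun v =>
    Summable.of_norm_bounded ((hasSum_norm v).summable.mul_left L) (hle v)
  have hn : ∀ v : Space, ‖∑' n, v n • u n‖ ≤ L * ‖v‖ := fun v =>
    tsum_of_norm_bounded ((hasSum_norm v).mul_left L) (hle v)
  let T : Space →ₗ[ℝ] E :=
    { toFun := fun v => ∑' n, v n • u n
      map_add' := fun v w => by
        rw [← (hs v).tsum_add (hs w)]
        congr 1; ext n; simp [add_smul]
      map_smul' := fun c v => by
        rw [RingHom.id_apply, ← (hs v).tsum_const_smul]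
        congr 1; ext n; simp [mul_smul] }
  refine ⟨T.mkContinuous L hn, fun n => ?_, hn⟩
  change ∑' m, (basisVec n) m • u m = u n
  rw [tsum_eq_single n]
  · simp [basisVec]
  · intro m hm
    simp [basisVec, Pi.single_eq_of_ne hm]

end ellOne

/-! ### Affine actions from rooted trees -/

namespace AffineGroupAction

/-- A uniformly bounded family of operators which is multiplicative, with a cocycle. -/
theorem exists_of_clm {G E : Type*} [Group G] [NormedAddCommGroup E] [NormedSpace ℝ E]
    (T : G → E →L[ℝ] E) (h1 : T 1 = 1) (hmul : ∀ s t, T (s * t) = T s * T t)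
    {L : ℝ} (hL : ∀ s v, ‖T s v‖ ≤ L * ‖v‖) (b : G → E)
    (hb : ∀ s t, b (s * t) = T s (b t) + b s) :
    ∃ σ : AffineGroupAction G E, σ.IsUniformlyLipschitz ∧ ∀ s, σ.act s 0 = b s := by
  let φ : G →* (E →L[ℝ] E) := ⟨⟨T, h1⟩, hmul⟩
  let π : G →* (E ≃L[ℝ] E) :=
    (ContinuousLinearEquiv.unitsEquiv ℝ E).toMonoidHom.comp φ.toHomUnits
  have hπ : ∀ s v, π s v = T s v := fun s v => rfl
  refine ⟨⟨π, b, fun s t => by rw [hπ, hb]⟩, ⟨max L 1, le_max_right _ _, fun s v w => ?_⟩,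
    fun s => by simp [act]⟩
  rw [act, act, dist_add_right, dist_eq_norm, dist_eq_norm, hπ, hπ, ← map_sub]
  exact (hL s _).trans (by gcongr; exact le_max_left _ _)

/-- A finite family of rooted tree structures on a group `G`, permuted by left translation up to
uniformly bounded distortion, gives a uniformly Lipschitz affine action on `ℓ¹`. Here `p i` is the
parent map of the `i`-th tree, and `B i x` is the path from `x` to the root `1`. -/
theorem exists_of_rootedTrees {G I : Type*} [Group G] [Countable G] [Fintype I] [DecidableEq G]
    (τ : G → I → I) (hτ1 : ∀ i, τ 1 i = i) (hτmul : ∀ s t i, τ (s * t) i = τ s (τ t i))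
    (p : I → G → G) (B : I → G → Finset G) (hB1 : ∀ i, B i 1 = ∅)
    (hB : ∀ i x, x ≠ 1 → x ∉ B i (p i x) ∧ B i x = insert x (B i (p i x)))
    (L : ℕ) (hL : ∀ s i x, x ≠ 1 →
      (symmDiff (B (τ s i) (s * x)) (B (τ s i) (s * p i x))).card ≤ L) :
    ∃ σ : AffineGroupAction G (lp (fun _ : ℕ => ℝ) 1), σ.IsUniformlyLipschitz ∧
      ∀ s, ∑ i, ((B i s).card : ℝ) ≤ ‖σ.act s 0‖ := by
  classical
  obtain ⟨ι, hι⟩ := exists_injective_nat (G × I)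
  let D : I → G → ellOne.Space := fun i x => ∑ w ∈ B i x, ellOne.basisVec (ι (w, i))
  have hD1 : ∀ i, D i 1 = 0 := fun i => by simp [D, hB1]
  have hDp : ∀ i x, x ≠ 1 → D i x = ellOne.basisVec (ι (x, i)) + D i (p i x) := by
    intro i x hx
    obtain ⟨h1, h2⟩ := hB i x hx
    simp only [D]
    rw [h2, Finset.sum_insert h1]
  have hDdiff : ∀ i x y, ‖D i x - D i y‖ ≤ (symmDiff (B i x) (B i y)).card := by
    intro i x y
    have hsum : ∀ A : Finset G, ‖∑ w ∈ A, ellOne.basisVec (ι (w, i))‖ ≤ A.card := fun A => by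
      refine (norm_sum_le _ _).trans ?_
      simp [ellOne.norm_basisVec]
    have : D i x - D i y = ∑ w ∈ B i x \ B i y, ellOne.basisVec (ι (w, i)) -
        ∑ w ∈ B i y \ B i x, ellOne.basisVec (ι (w, i)) := by
      simp only [D]
      rw [← Finset.sum_inter_add_sum_sdiff (B i x) (B i y),
        ← Finset.sum_inter_add_sum_sdiff (B i y) (B i x), Finset.inter_comm (B i y)]
      abel
    rw [this]
    refine (norm_sub_le _ _).trans ((add_le_add (hsum _) (hsum _)).trans ?_)
    rw [symmDiff, Finset.sup_eq_union, Finset.card_union_of_disjoint disjoint_sdiff_sdiff]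
    push_cast
    exact le_rfl
  -- The images of the basis vectors. Indices that label no edge, namely those of `(1, i)` and those
  -- outside the range of `ι`, are fixed by every `s`.
  let u : G → ℕ → ellOne.Space := fun s n =>
    if h : ∃ w : G × I, w.1 ≠ 1 ∧ ι w = n then
      D (τ s h.choose.2) (s * h.choose.1) - D (τ s h.choose.2) (s * p h.choose.2 h.choose.1)
    else ellOne.basisVec n
  have hu1 : ∀ s i x, x ≠ 1 → u s (ι (x, i)) = D (τ s i) (s * x) - D (τ s i) (s * p i x) := by
    intro s i x hx
    have h : ∃ w : G × I, w.1 ≠ 1 ∧ ι w = ι (x, i) := ⟨(x, i), hx, rfl⟩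
    have hw := hι h.choose_spec.2
    simp only [u]
    rw [dif_pos h, hw]
  have hu2 : ∀ s n, (¬ ∃ w : G × I, w.1 ≠ 1 ∧ ι w = n) → u s n = ellOne.basisVec n := by
    intro s n h
    simp only [u]
    rw [dif_neg h]
  have hubd : ∀ s n, ‖u s n‖ ≤ max (L : ℝ) 1 := by
    intro s n
    by_cases h : ∃ w : G × I, w.1 ≠ 1 ∧ ι w = n
    · obtain ⟨⟨x, i⟩, hx, rfl⟩ := h
      rw [hu1 s i x hx]
      refine (hDdiff _ _ _).trans (le_trans ?_ (le_max_left _ _))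
      exact_mod_cast hL s i x hx
    · rw [hu2 s n h, ellOne.norm_basisVec]
      exact le_max_right _ _
  choose T hT hTn using fun s => ellOne.exists_clm (u s) (hubd s)
  have hTD : ∀ s i (k : ℕ) x, (B i x).card = k → T s (D i x) = D (τ s i) (s * x) - D (τ s i) s := by
    intro s i k
    induction k with
    | zero =>
      intro x hx
      by_cases hx1 : x = 1
      · subst hx1; simp [hD1]
      · rw [(hB i x hx1).2] at hx
        simp at hx
    | succ k ih =>
      intro x hx
      have hx1 : x ≠ 1 := by
        rintro rfl
        simp [hB1] at hx
      obtain ⟨h1, h2⟩ := hB i x hx1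
      rw [h2, Finset.card_insert_of_notMem h1] at hx
      rw [hDp i x hx1, map_add, hT, hu1 s i x hx1, ih (p i x) (by omega)]
      abel
  have hTD' : ∀ s i x, T s (D i x) = D (τ s i) (s * x) - D (τ s i) s :=
    fun s i x => hTD s i _ x rfl
  have hT1 : T 1 = 1 := by
    refine ellOne.clm_ext fun n => ?_
    rw [hT]
    by_cases h : ∃ w : G × I, w.1 ≠ 1 ∧ ι w = n
    · obtain ⟨⟨x, i⟩, hx, rfl⟩ := h
      rw [hu1 1 i x hx, hτ1, one_mul, one_mul, hDp i x hx]
      simp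
    · rw [hu2 1 n h]; rfl
  have hTmul : ∀ s t, T (s * t) = T s * T t := by
    intro s t
    refine ellOne.clm_ext fun n => ?_
    rw [mul_apply_eq_comp, hT, hT]
    by_cases h : ∃ w : G × I, w.1 ≠ 1 ∧ ι w = n
    · obtain ⟨⟨x, i⟩, hx, rfl⟩ := h
      rw [hu1 _ i x hx, hu1 _ i x hx, map_sub, hTD', hTD', hτmul, mul_assoc, mul_assoc]
      abel
    · rw [hu2 _ n h, hu2 _ n h, hT, hu2 _ n h]
  have hbij : ∀ s, Function.Bijective (τ s) := by
    intro s
    refine Function.bijective_iff_has_inverse.2 ⟨τ s⁻¹, fun i => ?_, fun i => ?_⟩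
    · rw [← hτmul, inv_mul_cancel, hτ1]
    · rw [← hτmul, mul_inv_cancel, hτ1]
  obtain ⟨σ, hσ, hact⟩ := exists_of_clm T hT1 hTmul hTn (fun s => ∑ i, D i s) (by
    intro s t
    simp only [map_sum, hTD', Finset.sum_sub_distrib]
    rw [(hbij s).sum_comp (fun j => D j (s * t)), (hbij s).sum_comp (fun j => D j s)]
    abel)
  refine ⟨σ, hσ, fun s => ?_⟩
  -- The sum of the coordinates is a functional of norm at most one, and it counts the basis vectors
  -- in `b s`.
  obtain ⟨Φ, hΦ, hΦn⟩ := ellOne.exists_clm (fun _ => (1 : ℝ)) (L := 1) (by simp)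
  have h1 : Φ (∑ i, D i s) = ∑ i, ((B i s).card : ℝ) := by
    simp [D, hΦ]
  rw [hact, ← h1]
  have := hΦn (∑ i, D i s)
  rw [one_mul] at this
  exact (le_abs_self _).trans this

end AffineGroupAction

-- Quasi-trees do not split

universe u

open Relation

/-- A quasi-tree is coarsely connected, and it has a quasi-isometric embedding in a zero-hyperbolic
space. -/
theorem IsQuasiTree.exists_embedding {Y : Type u} [MetricSpace Y] (hY : IsQuasiTree Y) :
    ∃ (V : Type u) (_ : MetricSpace V) (q : Y → V) (A J : ℝ), IsZeroHyperbolic V ∧ 1 ≤ A ∧ 0 < J ∧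
      (∀ x y, dist x y ≤ A * dist (q x) (q y) + A) ∧
      (∀ x y, dist (q x) (q y) ≤ A * dist x y + A) ∧
      ∀ x y : Y, ReflTransGen (fun a b => dist a b ≤ J) x y := by
  obtain ⟨V, _, T, hT, hd, q, ⟨A, hA, hq⟩, C, hC, hdense⟩ := hY
  have hAA : A ≤ A * A := by nlinarith
  have hlow : ∀ x y, dist x y ≤ A * A * dist (q x) (q y) + A * A := fun x y => by
    have h := (hq x y).1
    rw [one_div, ← div_eq_inv_mul, sub_le_iff_le_add, div_le_iff₀ (by linarith)] at h
    nlinarith [dist_nonneg (x := q x) (y := q y)]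
  have hs : ∀ v, ∃ y, dist (q y) v < C := fun v => by
    obtain ⟨_, hv, y, rfl⟩ := hdense v
    exact ⟨y, hv⟩
  choose s hs using hs
  refine ⟨V, _, q, A * A, A * A * (1 + 2 * C) + A * A, isZeroHyperbolic_of_isTree hT hd,
    by nlinarith, by positivity, hlow,
    fun x y => (hq x y).2.trans (by gcongr), fun x y => ?_⟩
  have hstep : ∀ a b, dist (q a) (q b) ≤ 1 + 2 * C →
      dist a b ≤ A * A * (1 + 2 * C) + A * A := fun a b h => (hlow a b).trans (by gcongr)
  have h1 : dist x (s (q x)) ≤ A * A * (1 + 2 * C) + A * A :=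
    hstep _ _ (by rw [dist_comm]; linarith [hs (q x)])
  have h2 : dist (s (q y)) y ≤ A * A * (1 + 2 * C) + A * A := hstep _ _ (by linarith [hs (q y)])
  have h3 : ReflTransGen T.Adj (q x) (q y) :=
    (SimpleGraph.reachable_iff_reflTransGen _ _).1 (hT.connected.preconnected _ _)
  refine ReflTransGen.head h1 (ReflTransGen.tail ?_ h2)
  refine h3.lift s fun a b hab => hstep _ _ ?_
  have h4 : dist a b = 1 := by rw [hd, SimpleGraph.dist_eq_one_iff_adj.2 hab]; simp
  have h5 := dist_triangle4 (q (s a)) a b (q (s b))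
  have h6 := hs a
  have h7 := hs b
  rw [dist_comm] at h7
  linarith

/-- A coarse path can be projected to a slice: mixing replaces the `β`-coordinate of every point by
that of `p`, and this does not lengthen the jumps. -/
theorem exists_chain_of_mixing {Y A B : Type*} [MetricSpace Y] [MetricSpace A] [MetricSpace B]
    {J : ℝ} {α : Y → A} {β : Y → B}
    (hd : ∀ u v, dist u v = dist (α u) (α v) + dist (β u) (β v))
    (hmix : ∀ u v, ∃ m, α m = α u ∧ β m = β v) {u v p z : Y}
    (h : ReflTransGen (fun a b => dist a b ≤ J) u v) (hp : α p = α u) (hz : α z = α v)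
    (hpz : β z = β p) : ReflTransGen (fun a b => β b = β p ∧ dist a b ≤ J) p z := by
  induction h generalizing z with
  | refl =>
    have : dist p z = 0 := by rw [hd, hp, hz, hpz]; simp
    rw [dist_eq_zero.1 this]
  | @tail b c _ hbc ih =>
    obtain ⟨m, hm1, hm2⟩ := hmix b p
    refine (ih hm1 hm2).tail ⟨hpz, ?_⟩
    rw [hd, hm1, hz, hm2, hpz, dist_self, add_zero]
    have := hd b c
    linarith [dist_nonneg (x := β b) (y := β c)]

/-- If a quasi-tree splits as an `ℓ¹` product, one of the factors is bounded by a constant that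
depends only on the quasi-tree. -/
theorem IsQuasiTree.exists_bound_of_splitting {Y : Type u} [MetricSpace Y] (hY : IsQuasiTree Y) :
    ∃ D : ℝ, 0 ≤ D ∧ ∀ {A B : Type u} [MetricSpace A] [MetricSpace B] (α : Y → A) (β : Y → B),
      (∀ u v, dist u v = dist (α u) (α v) + dist (β u) (β v)) →
      (∀ u v, ∃ m, α m = α u ∧ β m = β v) →
      (∀ u v, dist (α u) (α v) ≤ D) ∨ ∀ u v, dist (β u) (β v) ≤ D := by
  obtain ⟨V, _, q, C, J, hV, hC, hJ, hlow, hup, hch⟩ := hY.exists_embedding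
  set J' : ℝ := C * J + C with hJ'
  have hJ'0 : 0 < J' := by positivity
  set E : ℝ := 2 * C * J' + C with hE
  have hE0 : 0 < E := by positivity
  -- `E` bounds the distance of two points whose images are less than `2 * J'` apart. `D` is so
  -- large that the midpoint of the diagonal below is more than `E` away from its ends.
  set D : ℝ := E + C * (2 * (C * E + J' + C)) + C with hD
  have hDE : E ≤ D := by
    have : 0 ≤ C * (2 * (C * E + J' + C)) := by positivity
    linarith
  refine ⟨D, hE0.le.trans hDE, ?_⟩
  intro A B _ _ α β hd hmix
  by_contra! hcon
  obtain ⟨⟨u, v, huv⟩, u', v', huv'⟩ := hcon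
  have hmono : ∀ {P P' : Y → Prop} {a b : Y}, (∀ y, P y → P' y) →
      ReflTransGen (fun a b => P b ∧ dist a b ≤ J) a b →
      ReflTransGen (fun a b => P' b ∧ dist (q a) (q b) ≤ J') a b := fun hP h =>
    ReflTransGen.mono (fun a b hab => ⟨hP _ hab.1,
      (hup a b).trans (by rw [hJ']; gcongr; exact hab.2)⟩) _ _ h
  have hd' : ∀ u v, dist u v = dist (β u) (β v) + dist (α u) (α v) := fun u v => by
    rw [hd, add_comm]
  have hmix' : ∀ u v, ∃ m, β m = β u ∧ α m = α v := fun u v => by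
    obtain ⟨m, h1, h2⟩ := hmix v u
    exact ⟨m, h2, h1⟩
  obtain ⟨p, hpα, hpβ⟩ := hmix u u'
  obtain ⟨z, hzα, hzβ⟩ := hmix v v'
  obtain ⟨r, hrα, hrβ⟩ := hmix v u'
  obtain ⟨t, htα, htβ⟩ := hmix u v'
  -- Large factors give a rectangle `p`, `r`, `z`, `t`. Both ways round it from `p` to `z` must pass
  -- the midpoint of the tree geodesic, so they come within `E` of each other; but opposite sides
  -- are far apart, and adjacent sides are close only near the corners `p` and `z` (or at `r` and
  -- `t`, within one route).
  have route₁ : ReflTransGen (fun a b => (β b = β u' ∨ α b = α v) ∧ dist (q a) (q b) ≤ J') p z :=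
    (hmono (fun y hy => Or.inl (hy.trans hpβ))
      (exists_chain_of_mixing hd hmix (hch u v) hpα hrα (hrβ.trans hpβ.symm))).trans
    (hmono (fun y hy => Or.inr (hy.trans hrα))
      (exists_chain_of_mixing hd' hmix' (hch u' v') hrβ hzβ (hzα.trans hrα.symm)))
  have route₂ : ReflTransGen (fun a b => (α b = α u ∨ β b = β v') ∧ dist (q a) (q b) ≤ J') p z :=
    (hmono (fun y hy => Or.inl (hy.trans hpα))
      (exists_chain_of_mixing hd' hmix' (hch u' v') hpβ htβ (htα.trans hpα.symm))).trans
    (hmono (fun y hy => Or.inr (hy.trans htβ))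
      (exists_chain_of_mixing hd hmix (hch u v) htα hzα (hzβ.trans htβ.symm)))
  set l : ℝ := dist (q p) (q z) / 2 with hl
  have hl0 : 0 ≤ l := by positivity
  have hll : l ≤ dist (q p) (q z) := by rw [hl]; linarith [dist_nonneg (x := q p) (y := q z)]
  have hlbig : C * E + J' + C ≤ l := by
    have h1 : D < dist p z := by
      rw [hd, hpα, hzα]
      linarith [dist_nonneg (x := β p) (y := β z)]
    have h2 := hlow p z
    have h3 : C * (2 * (C * E + J' + C)) ≤ C * dist (q p) (q z) := by linarith
    have h4 := le_of_mul_le_mul_left h3 (by linarith)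
    rw [hl]; linarith
  obtain ⟨y, hy, hy1, hy2⟩ := hV.exists_on_chain q hJ'0 (Or.inl hpβ) route₁ hll
  obtain ⟨y', hy', hy1', hy2'⟩ := hV.exists_on_chain q hJ'0 (Or.inl hpα) route₂ hll
  rw [max_eq_left hl0] at hy2 hy2'
  have hyy : dist y y' < E := by
    rw [gromovProduct_comm] at hy1'
    have h1 := hV.le_gromovProduct hy1 hy1'
    have h2 := dist_eq_sub_gromovProduct (q p) (q y) (q y')
    have h3 : dist (q y) (q y') < 2 * J' := by linarith
    have h4 := hlow y y'
    have h5 : C * dist (q y) (q y') < C * (2 * J') := by gcongr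
    rw [hE]; linarith
  have hfar : ∀ a b, C * E + C ≤ dist (q a) (q b) → E ≤ dist a b := fun a b h => by
    have h1 := hup a b
    exact le_of_mul_le_mul_left (by linarith : C * E ≤ C * dist a b) (by linarith)
  have hpy : E ≤ dist p y := hfar _ _ (by linarith [gromovProduct_le_left (q p) (q y) (q z)])
  have hyz : E ≤ dist y z := hfar _ _ (by
    have := dist_triangle (q p) (q y) (q z)
    linarith)
  have hαn := dist_nonneg (x := α y) (y := α y')
  have hβn := dist_nonneg (x := β y) (y := β y')
  rw [hd] at hyy
  rcases hy with hy | hy <;> rcases hy' with hy' | hy'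
  · rw [dist_comm, hd, hpα, hpβ, hy, dist_self, ← hy'] at hpy
    linarith
  · rw [hy, hy'] at hyy
    linarith
  · rw [hy, hy', dist_comm (α v)] at hyy
    linarith
  · rw [hd, hzα, hzβ, hy, dist_self, ← hy'] at hyz
    linarith

/-! ### Isometries of `ℓ¹` products -/

namespace PiLp

theorem dist_eq_sum_dist {ι : Type*} [Fintype ι] {X : ι → Type*}
    [∀ i, MetricSpace (X i)] (x y : PiLp 1 X) : dist x y = ∑ i, dist (x i) (y i) := by
  rw [dist_eq_sum (by simp)]; simp

theorem dist_coord_le {ι : Type*} [Fintype ι] {X : ι → Type*} [∀ i, MetricSpace (X i)]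
    (x y : PiLp 1 X) (i : ι) : dist (x i) (y i) ≤ dist x y := by
  rw [dist_eq_sum_dist]
  exact Finset.single_le_sum (f := fun i => dist (x i) (y i)) (fun _ _ => dist_nonneg)
    (Finset.mem_univ i)

/-- Betweenness in an `ℓ¹` product is coordinatewise. -/
theorem dist_coord_of_between {ι : Type*} [Fintype ι] {X : ι → Type*}
    [∀ i, MetricSpace (X i)] {x w y : PiLp 1 X} (h : dist x w + dist w y = dist x y) (k : ι) :
    dist (x k) (w k) + dist (w k) (y k) = dist (x k) (y k) := by
  simp only [dist_eq_sum_dist, ← Finset.sum_add_distrib] at h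
  exact ((Finset.sum_eq_sum_iff_of_le fun i _ => dist_triangle (x i) (w i) (y i)).1 h.symm k
    (Finset.mem_univ k)).symm

variable {ι : Type*} [DecidableEq ι] {X : ι → Type*}

/-- Replace the `i`-th coordinate of `x` by `u`. -/
def upd (x : PiLp 1 X) (i : ι) (u : X i) : PiLp 1 X := WithLp.toLp 1 (Function.update x i u)

@[simp]
theorem upd_same (x : PiLp 1 X) (i : ι) (u : X i) : x.upd i u i = u :=
  Function.update_self i u x

@[simp]
theorem upd_of_ne (x : PiLp 1 X) {i k : ι} (h : k ≠ i) (u : X i) : x.upd i u k = x k :=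
  Function.update_of_ne h u x

@[simp]
theorem upd_eq_self (x : PiLp 1 X) (i : ι) : x.upd i (x i) = x := by
  ext k
  by_cases h : k = i
  · subst h; simp
  · simp [h]

variable [Fintype ι] [∀ i, MetricSpace (X i)]

theorem dist_upd_upd (x y : PiLp 1 X) (i : ι) (u v : X i) :
    dist (x.upd i u) (y.upd i v) = dist u v + ∑ k ∈ Finset.univ.erase i, dist (x k) (y k) := by
  rw [dist_eq_sum_dist, ← Finset.add_sum_erase _ _ (Finset.mem_univ i), upd_same, upd_same]
  congr 1
  refine Finset.sum_congr rfl fun k hk => ?_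
  have := Finset.ne_of_mem_erase hk
  simp [this]

theorem dist_upd_upd_self (x : PiLp 1 X) (i : ι) (u v : X i) :
    dist (x.upd i u) (x.upd i v) = dist u v := by
  rw [dist_upd_upd]; simp

/-- An isometry of an `ℓ¹` product maps parallel pairs to parallel pairs. -/
theorem dist_coord_isometry_upd {h : PiLp 1 X → PiLp 1 X} (hh : Isometry h) (a b : PiLp 1 X)
    (i j : ι) (u v : X j) :
    dist (h (a.upd j u) i) (h (a.upd j v) i) = dist (h (b.upd j u) i) (h (b.upd j v) i) := by
  -- Changing coordinate `j` first and the others afterwards is geodesic. Applied at the four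
  -- corners of a rectangle, this makes opposite sides equal in each coordinate of the image.
  have H : ∀ (a b : PiLp 1 X) (u v : X j),
      dist (h (a.upd j u) i) (h (a.upd j v) i) + dist (h (a.upd j v) i) (h (b.upd j v) i) =
      dist (h (a.upd j u) i) (h (b.upd j v) i) := fun a b u v => by
    refine dist_coord_of_between ?_ i
    simp only [hh.dist_eq, dist_upd_upd]
    simp
  have h1 := H a b u v
  have h2 := H b a v u
  have h3 := H a b v u
  have h4 := H b a u v
  simp only [dist_comm (h (b.upd j v) i), dist_comm (h (b.upd j u) i) (h (a.upd j u) i),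
    dist_comm (h (b.upd j u) i) (h (a.upd j v) i),
    dist_comm (h (a.upd j v) i) (h (a.upd j u) i)] at h1 h2 h3 h4 ⊢
  linarith

/-- The image of a coordinate line under an isometry of an `ℓ¹` product is closed under mixing
coordinates. -/
theorem exists_upd_eq (g : PiLp 1 X ≃ᵢ PiLp 1 X) (a : PiLp 1 X) (i j : ι) (u v : X j) :
    ∃ m, g (a.upd j m) = (g (a.upd j v)).upd i (g (a.upd j u) i) := by
  set w : PiLp 1 X := g.symm ((g (a.upd j v)).upd i (g (a.upd j u) i)) with hw
  have hgw : g w = (g (a.upd j v)).upd i (g (a.upd j u) i) := by rw [hw, g.apply_symm_apply]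
  -- The mixed point lies between the two images, so `w` lies between two points of a coordinate
  -- line and must be on that line.
  have hb : dist (a.upd j u) w + dist w (a.upd j v) = dist (a.upd j u) (a.upd j v) := by
    rw [← g.isometry.dist_eq, ← g.isometry.dist_eq w, ← g.isometry.dist_eq (a.upd j u), hgw]
    conv_lhs =>
      rw [← upd_eq_self (g (a.upd j u)) i]
      arg 2
      rw [← upd_eq_self (g (a.upd j v)) i]
    conv_rhs => rw [← upd_eq_self (g (a.upd j u)) i, ← upd_eq_self (g (a.upd j v)) i]
    simp only [dist_upd_upd, upd_same]
    simp [add_comm]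
  refine ⟨w j, ?_⟩
  rw [← hgw]
  congr 1
  ext k
  by_cases hk : k = j
  · subst hk; simp
  · have h1 := dist_coord_of_between hb k
    rw [upd_of_ne _ hk, upd_of_ne _ hk, dist_self] at h1
    rw [upd_of_ne _ hk]
    refine dist_eq_zero.1 ?_
    linarith [dist_nonneg (x := a k) (y := w k), dist_nonneg (x := w k) (y := a k)]

end PiLp

/-! ### Coarse permutation of the factors -/

/-- The coordinate controlling an unbounded coordinate of the image is unique. -/
theorem coarse_coordinate_unique {ι : Type*} [DecidableEq ι] {X : ι → Type*}
    [∀ i, MetricSpace (X i)] {g : PiLp 1 X → PiLp 1 X} (hg : Function.Surjective g)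
    (a : PiLp 1 X) {j i i' : ι} {K K' : ℝ}
    (hj : ¬ ∃ M, ∀ u v : X j, dist u v ≤ M)
    (h : ∀ x y, dist (g x j) (g y j) ≤ dist (x i) (y i) + K)
    (h' : ∀ x y, dist (g x j) (g y j) ≤ dist (x i') (y i') + K') : i = i' := by
  by_contra hii
  refine hj ⟨K' + K, fun u v => ?_⟩
  obtain ⟨x, hx⟩ := hg (a.upd j u)
  obtain ⟨y, hy⟩ := hg (a.upd j v)
  have h1 := h' x (x.upd i (y i))
  have h2 := h (x.upd i (y i)) y
  rw [PiLp.upd_of_ne _ (Ne.symm hii), dist_self, hx] at h1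
  rw [PiLp.upd_same, dist_self, hy] at h2
  rw [PiLp.upd_same] at h1 h2
  linarith [dist_triangle u (g (x.upd i (y i)) j) v]

section Coordinates

variable {ι : Type} [Fintype ι] [DecidableEq ι] {X : ι → Type u} [∀ i, MetricSpace (X i)]

/-- An isometry of an `ℓ¹` product of quasi-trees permutes the unbounded factors coarsely: up to an
additive constant, each coordinate of the image is controlled by one coordinate. -/
theorem exists_coarse_coordinate (hX : ∀ i, IsQuasiTree (X i)) :
    ∃ K : ℝ, ∀ (g : PiLp 1 X ≃ᵢ PiLp 1 X) (j : ι), ∃ i, ∀ x y : PiLp 1 X,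
      dist (g x j) (g y j) ≤ dist (x i) (y i) + K := by
  choose D hD0 hD using fun i => (hX i).exists_bound_of_splitting
  refine ⟨Fintype.card ι * ∑ j, D j, fun g j => ?_⟩
  rcases isEmpty_or_nonempty (PiLp 1 X) with hemp | ⟨⟨a⟩⟩
  · exact ⟨j, fun x => hemp.elim x⟩
  -- Displacement in coordinate `i` of the preimage of the `j`-line through `a`. This preimage
  -- splits into coordinate `i` and the rest, so at most one `i` has displacement above `D j`.
  set c : ι → X j → X j → ℝ :=
    fun i u v => dist (g.symm (a.upd j u) i) (g.symm (a.upd j v) i) with hc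
  have hdich : ∀ i, (∀ u v, c i u v ≤ D j) ∨ ∀ k, k ≠ i → ∀ u v, c k u v ≤ D j := by
    intro i
    have hβ : ∀ u v : X j,
        dist ((g.symm (a.upd j u)).upd i (a i)) ((g.symm (a.upd j v)).upd i (a i)) =
        ∑ k ∈ Finset.univ.erase i, c k u v := fun u v => by
      rw [PiLp.dist_upd_upd, dist_self, zero_add]
    refine (hD j (fun u => g.symm (a.upd j u) i) (fun u => (g.symm (a.upd j u)).upd i (a i))
      (fun u v => ?_) fun u v => ?_).imp id fun h k hk u v => ?_
    · rw [hβ, ← PiLp.dist_upd_upd_self a j u v, ← g.symm.isometry.dist_eq, PiLp.dist_eq_sum_dist,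
        ← Finset.add_sum_erase _ _ (Finset.mem_univ i)]
    · obtain ⟨m, hm⟩ := PiLp.exists_upd_eq g.symm a i j u v
      refine ⟨m, by simp [hm], ?_⟩
      simp only [hm]
      ext k
      by_cases hk : k = i
      · subst hk; simp
      · simp [hk]
    · have h1 := h u v
      rw [hβ] at h1
      exact (Finset.single_le_sum (f := fun k => c k u v) (fun _ _ => dist_nonneg)
        (Finset.mem_erase.2 ⟨hk, Finset.mem_univ k⟩)).trans h1
  obtain ⟨i, hi⟩ : ∃ i, ∀ k, k ≠ i → ∀ u v, c k u v ≤ D j := by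
    by_cases hall : ∀ i u v, c i u v ≤ D j
    · exact ⟨j, fun k _ => hall k⟩
    · push Not at hall
      obtain ⟨i, u, v, hi⟩ := hall
      exact ⟨i, (hdich i).resolve_left fun h => absurd (h u v) (not_le.2 hi)⟩
  refine ⟨i, fun x y => ?_⟩
  -- Mixing replaces the change of coordinate `k` by one that `g` maps into a `j`-line with the same
  -- effect on coordinate `j`; by parallelism its size is a value of `c k`.
  have hone : ∀ (x : PiLp 1 X) k, k ≠ i → ∀ t, dist (g x j) (g (x.upd k t) j) ≤ D j := by
    intro x k hk t
    obtain ⟨m, hm⟩ := PiLp.exists_upd_eq g x j k t (x k)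
    rw [PiLp.upd_eq_self] at hm
    have h1 : dist (g x j) (g (x.upd k t) j) = dist (x k) m := by
      rw [← PiLp.dist_upd_upd_self x k, PiLp.upd_eq_self, ← g.isometry.dist_eq, hm]
      nth_rw 2 [← PiLp.upd_eq_self (g x) j]
      rw [PiLp.dist_upd_upd_self]
    have h2 : dist (x k) m = c k (g x j) (g (x.upd k t) j) := by
      simp only [hc]
      rw [PiLp.dist_coord_isometry_upd g.symm.isometry a (g x) k j, ← hm, PiLp.upd_eq_self,
        g.symm_apply_apply, g.symm_apply_apply, PiLp.upd_same]
    rw [h1, h2]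
    exact hi k hk _ _
  have hmany : ∀ s : Finset ι, i ∉ s →
      dist (g x j) (g (WithLp.toLp 1 (s.piecewise y x)) j) ≤ s.card * D j := by
    intro s
    induction s using Finset.induction_on with
    | empty => intro _; simp
    | insert k s hks ih =>
      intro his
      rw [Finset.mem_insert, not_or] at his
      have h1 := ih his.2
      have h2 := hone (WithLp.toLp 1 (s.piecewise y x)) k (Ne.symm his.1) (y k)
      have h3 : PiLp.upd (WithLp.toLp 1 (s.piecewise y x)) k (y k) =
          WithLp.toLp 1 ((insert k s).piecewise y x) := by
        rw [Finset.piecewise_insert]; rfl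
      rw [h3] at h2
      rw [Finset.card_insert_of_notMem hks]
      push_cast
      linarith [dist_triangle (g x j) (g (WithLp.toLp 1 (s.piecewise y x)) j)
        (g (WithLp.toLp 1 ((insert k s).piecewise y x)) j)]
  have h1 := hmany (Finset.univ.erase i) (Finset.notMem_erase _ _)
  have h2 : WithLp.toLp 1 ((Finset.univ.erase i).piecewise y x) = y.upd i (x i) := by
    ext k
    by_cases hk : k = i
    · subst hk; simp
    · simp [hk]
  rw [h2] at h1
  have h3 : dist (g (y.upd i (x i)) j) (g y j) ≤ dist (x i) (y i) := by
    refine (PiLp.dist_coord_le _ _ j).trans ?_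
    rw [g.isometry.dist_eq]
    nth_rw 2 [← PiLp.upd_eq_self y i]
    rw [PiLp.dist_upd_upd_self]
  have h4 : ((Finset.univ.erase i).card : ℝ) * D j ≤ Fintype.card ι * ∑ j, D j := by
    have h5 : D j ≤ ∑ j, D j :=
      Finset.single_le_sum (fun i _ => hD0 i) (Finset.mem_univ j)
    have h6 : ((Finset.univ.erase i).card : ℝ) ≤ Fintype.card ι := by
      exact_mod_cast Finset.card_le_univ _
    have := hD0 j
    gcongr
  linarith [dist_triangle (g x j) (g (y.upd i (x i)) j) (g y j)]

/-- A group acting isometrically on an `ℓ¹` product of quasi-trees permutes the unbounded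
factors. -/
theorem exists_coordinate_action {G : Type*} [Group G] (hX : ∀ i, IsQuasiTree (X i))
    [MulAction G (PiLp 1 X)] [IsIsometricSMul G (PiLp 1 X)] (o : PiLp 1 X) :
    ∃ (K : ℝ) (τ : G → {i // ¬ ∃ M, ∀ u v : X i, dist u v ≤ M} →
        {i // ¬ ∃ M, ∀ u v : X i, dist u v ≤ M}),
      (∀ i, τ 1 i = i) ∧ (∀ s t i, τ (s * t) i = τ s (τ t i)) ∧
      ∀ s i (x y : PiLp 1 X), dist ((s • x) (τ s i)) ((s • y) (τ s i)) ≤ dist (x i) (y i) + K := by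
  obtain ⟨K, hK⟩ := exists_coarse_coordinate hX
  have hex : ∀ (s : G) (j : {i // ¬ ∃ M, ∀ u v : X i, dist u v ≤ M}),
      ∃ i : {i // ¬ ∃ M, ∀ u v : X i, dist u v ≤ M},
      ∀ x y : PiLp 1 X, dist ((s • x) j) ((s • y) j) ≤ dist (x i) (y i) + K := by
    intro s j
    obtain ⟨i, hi⟩ := hK (IsometryEquiv.constSMul s) j
    refine ⟨⟨i, ?_⟩, hi⟩
    rintro ⟨M, hM⟩
    refine j.2 ⟨M + K, fun u v => ?_⟩
    have h1 := hi (s⁻¹ • o.upd j u) (s⁻¹ • o.upd j v)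
    simp only [IsometryEquiv.constSMul_apply, smul_inv_smul, PiLp.upd_same] at h1
    linarith [hM ((s⁻¹ • o.upd j u) i) ((s⁻¹ • o.upd j v) i)]
  choose ν hν using hex
  -- Any additive constant `K'` is allowed, so composition may double `K`; the index found is the
  -- same and the estimate with `K` itself is kept.
  have huniq : ∀ (s : G) j i (K' : ℝ),
      (∀ x y : PiLp 1 X, dist ((s • x) j.1) ((s • y) j.1) ≤ dist (x i) (y i) + K') → i = ν s j :=
    fun s j i K' h => coarse_coordinate_unique (g := fun x => s • x) (MulAction.surjective s) o j.2
      h (hν s j)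
  have hν1 : ∀ j, ν 1 j = j := fun j => (Subtype.ext (huniq 1 j j 0 (by simp))).symm
  have hνmul : ∀ s t j, ν (s * t) j = ν t (ν s j) := fun s t j => by
    refine (Subtype.ext (huniq (s * t) j _ (K + K) fun x y => ?_)).symm
    have h1 := hν s j (t • x) (t • y)
    have h2 := hν t (ν s j) x y
    rw [mul_smul, mul_smul]
    linarith
  -- `ν s` sends a target coordinate to its source and reverses products, hence the inverse.
  refine ⟨K, fun s => ν s⁻¹, fun i => by simp [hν1], fun s t i => ?_, fun s i x y => ?_⟩
  · simp only [mul_inv_rev]; exact hνmul _ _ _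
  · have h := hν s (ν s⁻¹ i) x y
    rwa [← hνmul, inv_mul_cancel, hν1] at h

end Coordinates

/-! ### Finitely generated groups and the conclusion -/

theorem Group.FG.countable {G : Type*} [Group G] [hG : Group.FG G] : Countable G := by
  obtain ⟨α, _, f, hf⟩ := Group.fg_iff_exists_freeGroup_hom_surjective_finite.1 hG
  have : Countable (FreeGroup α) :=
    (Quot.mk_surjective (r := FreeGroup.Red.Step (α := α))).countable
  exact hf.countable

/-- Orbits of a finitely generated group are coarsely connected. -/
theorem Group.FG.exists_chain {G Y : Type*} [Group G] [hG : Group.FG G] [PseudoMetricSpace Y]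
    [MulAction G Y] [IsIsometricSMul G Y] (o : Y) :
    ∃ R : ℝ, 0 ≤ R ∧ ∀ x : G, ReflTransGen (fun a b : G => dist (a • o) (b • o) ≤ R) 1 x := by
  obtain ⟨S, hS, hfin⟩ := Group.fg_iff.1 hG
  obtain ⟨R, hR⟩ : ∃ R : ℝ, ∀ a ∈ S, dist o (a • o) ≤ R := by
    obtain ⟨R, hR⟩ := (hfin.image fun a => dist o (a • o)).bddAbove
    exact ⟨R, fun a ha => hR ⟨a, ha, rfl⟩⟩
  refine ⟨max R 0, le_max_right _ _, fun x => ?_⟩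
  have hx : x ∈ Subgroup.closure S := by rw [hS]; trivial
  induction hx using Subgroup.closure_induction_right with
  | one => exact ReflTransGen.refl
  | mul_right x hx a ha ih =>
    refine ih.tail ?_
    rw [mul_smul, dist_smul]
    exact (hR a ha).trans (le_max_left _ _)
  | mul_inv_cancel x hx a ha ih =>
    refine ih.tail ?_
    rw [mul_smul, dist_smul, ← dist_smul a, smul_inv_smul, dist_comm]
    exact (hR a ha).trans (le_max_left _ _)

theorem theorem1p2 {G : Type*} [Group G] [Group.FG G] {N : ℕ} {X : Fin N → Type*}
    [∀ i, MetricSpace (X i)] (hX : ∀ i, IsQuasiTree (X i))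
    [MulAction G (PiLp 1 X)] [IsIsometricSMul G (PiLp 1 X)] (o : PiLp 1 X) :
    ∃ σ : AffineGroupAction G (lp (fun _ : ℕ => ℝ) 1), σ.IsUniformlyLipschitz ∧
      ∃ C : ℝ, 0 < C ∧ ∀ s : G, ‖σ.act s 0‖ ≥ 1 / C * dist (s • o) o - C := by
  classical
  have := Group.FG.countable (G := G)
  obtain ⟨K, τ, hτ1, hτmul, hτ⟩ := exists_coordinate_action (G := G) hX o
  obtain ⟨R, hR0, hR⟩ := Group.FG.exists_chain (G := G) o
  choose V _ q A _ hV hA _ hlow hup _ using fun i => (hX i).exists_embedding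
  set f : ∀ i, G → V i := fun i s => q i ((s • o) i) with hf
  set J : Fin N → ℝ := fun i => A i * R + A i with hJ
  have hJ0 : ∀ i, 0 < J i := fun i => by
    have := hA i
    simp only [hJ]; positivity
  have hchain : ∀ i x, ReflTransGen (fun a b => dist (f i a) (f i b) ≤ J i) 1 x := fun i x =>
    ReflTransGen.mono (fun a b hab => (hup i _ _).trans (by
      have := hA i
      simp only [hJ]
      gcongr
      exact (PiLp.dist_coord_le _ _ i).trans hab)) _ _ (hR x)
  choose p B hB1 hB hp hBL using fun i => (hV i).exists_parent (f i) (hJ0 i) 1 (hchain i)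
  -- The length in `X i` of an edge from `x` to its parent, which is at most `3 * J i` in the tree.
  set E : Fin N → ℝ := fun i => A i * (3 * J i) + A i with hE
  have hpE : ∀ i x, x ≠ 1 → dist ((x • o) i) ((p i x • o) i) ≤ E i := fun i x hx => by
    have := hA i
    refine (hlow i _ _).trans ?_
    simp only [hE]
    gcongr
    exact hp i x hx
  have hcard : ∀ i (k : ℕ) x, (B i x).card = k → dist ((x • o) i) (o i) ≤ E i * k := by
    intro i k
    induction k with
    | zero =>
      intro x hx
      by_cases hx1 : x = 1
      · simp [hx1]
      · rw [(hB i x hx1).2] at hx; simp at hx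
    | succ k ih =>
      intro x hx
      have hx1 : x ≠ 1 := by rintro rfl; simp [hB1] at hx
      obtain ⟨h1, h2⟩ := hB i x hx1
      rw [h2, Finset.card_insert_of_notMem h1] at hx
      have h3 := ih (p i x) (by omega)
      have h4 := hpE i x hx1
      push_cast
      linarith [dist_triangle ((x • o) i) ((p i x • o) i) (o i)]
  have hE0 : ∀ i, 0 < E i := fun i => by
    have := hA i
    have := hJ0 i
    simp only [hE]; positivity
  -- A bound, for all `s` and all pairs of factors at once, on the length of a translated edge: `s`
  -- adds at most `K`, and the map to the tree costs `A j`.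
  set M : ℝ := ∑ i, ∑ j, (A j * (E i + |K|) + A j) with hM
  choose L hL using fun i => hBL i M
  have hLsum : ∀ i, L i ≤ ∑ j, L j := fun i =>
    Finset.single_le_sum (fun _ _ => Nat.zero_le _) (Finset.mem_univ i)
  obtain ⟨σ, hσ, hcardσ⟩ := AffineGroupAction.exists_of_rootedTrees τ hτ1 hτmul
    (fun i => p i) (fun i => B i) (fun i => hB1 i) (fun i => hB i) (∑ j, L j) (by
      intro s i x hx
      refine (hL (τ s i) _ _ ?_).trans (hLsum _)
      have h1 := hτ s i (x • o) (p i x • o)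
      rw [← mul_smul, ← mul_smul] at h1
      have h2 := hpE i x hx
      have hnn : ∀ i j, 0 ≤ A j * (E i + |K|) + A j := fun i j => by
        have := hA j
        have := hE0 i
        positivity
      have h3 : A (τ s i) * (E i + |K|) + A (τ s i) ≤ M :=
        (Finset.single_le_sum (f := fun j => A j * (E i + |K|) + A j) (fun j _ => hnn i j)
          (Finset.mem_univ (τ s i).1)).trans
        (Finset.single_le_sum (f := fun i => ∑ j, (A j * (E i + |K|) + A j))
          (fun i _ => Finset.sum_nonneg fun j _ => hnn i j) (Finset.mem_univ i.1))
      refine le_trans ((hup _ _ _).trans ?_) h3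
      have := hA (τ s i)
      gcongr
      linarith [le_abs_self K])
  refine ⟨σ, hσ, ?_⟩
  have hbd : ∀ i, ∃ b : ℝ, 0 ≤ b ∧
      ((∃ M, ∀ u v : X i, dist u v ≤ M) → ∀ u v : X i, dist u v ≤ b) := by
    intro i
    by_cases h : ∃ M, ∀ u v : X i, dist u v ≤ M
    · obtain ⟨M, hM⟩ := h
      exact ⟨max M 0, le_max_right _ _, fun _ u v => (hM u v).trans (le_max_left _ _)⟩
    · exact ⟨0, le_rfl, fun h' => absurd h' h⟩
  choose b hb0 hb using hbd
  set E' : ℝ := 1 + ∑ i, E i with hE'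
  set b' : ℝ := ∑ i, b i with hb'
  have hE'1 : 1 ≤ E' := by
    have := Finset.sum_nonneg fun i (_ : i ∈ Finset.univ) => (hE0 i).le
    linarith
  have hb'0 : 0 ≤ b' := Finset.sum_nonneg fun i _ => hb0 i
  have hEE' : ∀ i, E i ≤ E' := fun i => by
    have := Finset.single_le_sum (f := E) (fun i _ => (hE0 i).le) (Finset.mem_univ i)
    linarith
  refine ⟨E' + b', by positivity, fun s => ?_⟩
  have hdist : dist (s • o) o ≤ E' * ‖σ.act s 0‖ + b' := by
    rw [PiLp.dist_eq_sum_dist]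
    -- Unbounded factors are controlled by depth in their rooted tree; bounded factors, absent from
    -- the action, contribute only the constant `b i`.
    have h1 : ∀ i, dist ((s • o) i) (o i) ≤
        (if ¬ ∃ M, ∀ u v : X i, dist u v ≤ M then E' * ((B i s).card : ℝ) else 0) + b i := by
      intro i
      split_ifs with h
      · exact (hb i h _ _).trans (by simp)
      · have h2 := hcard i _ s rfl
        have h3 : E i * ((B i s).card : ℝ) ≤ E' * (B i s).card := by
          gcongr; exact hEE' i
        linarith [hb0 i]
    refine (Finset.sum_le_sum fun i _ => h1 i).trans ?_
    rw [Finset.sum_add_distrib, ← Finset.sum_filter, ← Finset.mul_sum]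
    gcongr
    refine le_trans (le_of_eq ?_) (hcardσ s)
    exact (Finset.sum_subtype _ (by simp) fun i => ((B i s).card : ℝ))
  have hn := norm_nonneg (σ.act s 0)
  have hC : 1 ≤ E' + b' := by linarith
  rw [ge_iff_le, sub_le_iff_le_add, one_div, ← div_eq_inv_mul, div_le_iff₀ (by linarith)]
  nlinarith
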